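/- Let $m$ and $p$ be positive integers, let $n\ge 0$ be an integer, and write $[N]=\{1,\dots,N\}$. The Fuss–Catalan numbers are $A_n^{q}=\frac{1}{qn+1}\binom{qn+1}{n}$. A set partition of $[N]$ is planar (non-crossing) if its standard diagram, in which $i<j$ are joined by an arc exactly when they lie in the same block and no $k$ with $i<k<j$ lies in that block, has no two crossing arcs, that is, no arcs $(i,k)$ and $(j,l)$ with $i<j<k<l$. An $m$-tuple planar partition of $[N]$ is a sequence $(P_1,\dots,P_m)$ of (not necessarily distinct) planar partitions of $[N]$ such that for each $r<m$ every block of $P_r$ is contained in a block of $P_{r+1}$. Then the number of $m$-tuple planar partitions $(P_1,\dots,P_m)$ of $[pn]$ in which every block of $P_1$ has exactly $p$ elements (that is, $P_1$ is a $p$-partition) is $A_n^{mp}$. -/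

import Mathlib

/-- The Fuss-Catalan number `A_n^p = 1 / (p n + 1) * binom (p n + 1) n`, as a rational number. -/
def fussCatalan (p n : ℕ) : ℚ :=
  1 / ((p : ℚ) * n + 1) * ((p * n + 1).choose n : ℚ)

/-- A set partition of `[N] = {1, …, N}`: a set of nonempty pairwise disjoint blocks with union
`[N]`. The order `≤` on these partitions is refinement: `P ≤ Q` means that every block of `P` is
contained in a block of `Q`. -/
abbrev SetPartition (N : ℕ) : Type := Finpartition (Finset.Icc 1 N)

/-- `(i, j)` is an arc of the standard diagram of `P`: the points `i < j` lie in the same block,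
and that block has no point strictly between them. -/
def SetPartition.IsArc {N : ℕ} (P : SetPartition N) (i j : ℕ) : Prop :=
  i < j ∧ ∃ B ∈ P.parts, i ∈ B ∧ j ∈ B ∧ ∀ k ∈ B, ¬ (i < k ∧ k < j)

/-- A partition is planar (non-crossing) if no two arcs of its standard diagram cross. -/
def SetPartition.IsPlanar {N : ℕ} (P : SetPartition N) : Prop :=
  ∀ i j k l : ℕ, P.IsArc i k → P.IsArc j l → ¬ (i < j ∧ j < k ∧ k < l)

/-- Every block of `P` has exactly `p` elements; for a partition of `[p n]` this says that `P` is a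
`p`-partition. -/
def SetPartition.IsUniform {N : ℕ} (P : SetPartition N) (p : ℕ) : Prop :=
  ∀ B ∈ P.parts, B.card = p

/-- An `m`-tuple planar partition of `[N]`: a sequence of `m` planar partitions of `[N]`, each of
the first `m - 1` being a refinement of the next one. -/
def IsPlanarTuple {m N : ℕ} (Q : Fin m → SetPartition N) : Prop :=
  (∀ r : Fin m, (Q r).IsPlanar) ∧
    ∀ (r : ℕ) (hr : r + 1 < m), Q ⟨r, Nat.lt_of_succ_lt hr⟩ ≤ Q ⟨r + 1, hr⟩

/-!
Noncrossing partitions are counted with weights. Let `w` be a power series over `ℚ` with constant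
coefficient `1`, and give a block of size `d` the weight `coeff d w`. The sum over all noncrossing
partitions of an `n`-element set is the coefficient of `X ^ n` in the series `F` with `F = w (X F)`
(`gapSum_eq_coeff`). For the proof, the block of the least point gets separate weights `v`;
deleting that point replaces `v` by `(w v - w₀ v₀) / X` (`blockSum_insert`), and the coefficients of
`F * v (X F)` obey the same recursion (`coeff_succ_mul_subst`).

The noncrossing refinements of a noncrossing partition are chosen independently in its blocks
(`sum_noncrossing_refinements`). Hence summing over the finest member of a chain only replaces the
weights `w` by the weights `F` (`chainSum_succ`), and the weighted number of chains of length `m` is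
given by the `m`-th iterate of `w ↦ F`. Partitions into blocks of size `p` are selected by
`w = 1 + X ^ p`. Let `F_k` be the solution of `F_k = 1 + X ^ p * F_k ^ k`. Then `F_0 = 1 + X ^ p`,
and `F_{rp} (X F_{(r+1)p})` and `F_{(r+1)p}` both solve `Y = 1 + (X F_{(r+1)p}) ^ p * Y ^ (rp)`, so
they are equal (`subst_fussSeries`) and the `m`-th iterate is `F_{mp}`.

The coefficients of `F_k` are Fuss–Catalan numbers: the numbers of forests of `s` trees of arity `k`
satisfy a two-term recursion, which is solved by `s / (k n + s) * binom (k n + s) n`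
(`forestCount_closed_form`) and also makes the generating functions multiplicative in `s`
(`forestSeries_mul`). This replaces Lagrange inversion.
-/

open Finset PowerSeries

/-! ### Fuss–Catalan power series -/

/-- The number of ordered forests of `s` (possibly empty) `k`-ary trees with `n` nodes in total.
The recursion looks at the first tree: it is empty, or its root is replaced by its `k` subtrees. -/
def forestCount (k : ℕ) : ℕ → ℕ → ℕ
  | 0, _ => 1
  | _ + 1, 0 => 0
  | n + 1, s + 1 => forestCount k (n + 1) s + forestCount k n (s + k)
termination_by n s => (n, s)

theorem forestCount_closed_form (k : ℕ) (hk : 0 < k) (n s : ℕ) (h : 0 < n + s) :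
    (forestCount k n s : ℚ) = s / (k * n + s) * ((k * n + s).choose n : ℚ) := by
  induction n, s using forestCount.induct k with
  | case1 s =>
    have hs : (s : ℚ) ≠ 0 := by
      have : 0 < s := by omega
      positivity
    simp [forestCount, hs]
  | case2 n => simp [forestCount]
  | case3 n s ih₁ ih₂ =>
    have e : k * n + (s + k) = k * (n + 1) + s := by ring
    have hle : n + 1 ≤ k * (n + 1) + s := by nlinarith
    have ih₁ := ih₁ (by omega)
    have ih₂ := ih₂ (by omega)
    rw [e] at ih₂
    rw [forestCount, Nat.cast_add, ih₁, ih₂, ← add_assoc (k * (n + 1)) s 1]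
    obtain ⟨t, ht⟩ := Nat.exists_eq_add_of_le hle
    -- With `M = k (n + 1) + s`, all binomials are multiples of `M.choose n`.
    have c₁ := Nat.choose_succ_right_eq (k * (n + 1) + s) n
    have c₂ : (k * (n + 1) + s + 1).choose (n + 1)
        = (k * (n + 1) + s).choose n + (k * (n + 1) + s).choose (n + 1) := Nat.choose_succ_succ _ _
    have hsub : k * (n + 1) + s - n = t + 1 := by omega
    rw [hsub] at c₁
    rw [c₂]
    have c₁' : ((k * (n + 1) + s).choose (n + 1) : ℚ) * (n + 1)
        = (k * (n + 1) + s).choose n * (t + 1) := by exact_mod_cast c₁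
    have c₃ : ((k * (n + 1) + s).choose (n + 1) : ℚ)
        = (k * (n + 1) + s).choose n * (t + 1) / (n + 1) := by
      rw [← c₁']; field_simp
    have hM : (k : ℚ) * (n + 1) + s = n + 1 + t := by exact_mod_cast ht
    have hs : (s : ℚ) = n + 1 + t - k * (n + 1) := by linarith
    push_cast
    rw [c₃]
    have h₁ : (k : ℚ) * n + (s + k) = n + 1 + t := by linarith
    have h₂ : (k : ℚ) * (n + 1) + (s + 1) = n + 1 + t + 1 := by linarith
    rw [h₁, h₂, hM, hs]
    have : (n : ℚ) + 1 + t ≠ 0 := by positivity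
    have : (n : ℚ) + 1 + t + 1 ≠ 0 := by positivity
    field_simp
    ring

/-- The generating function of forests of `s` trees of arity `k`, by number of nodes. -/
noncomputable def forestSeries (k s : ℕ) : ℚ⟦X⟧ := mk fun n => (forestCount k n s : ℚ)

theorem forestSeries_zero (k : ℕ) : forestSeries k 0 = 1 := by
  ext n
  cases n <;> simp [forestSeries, forestCount, coeff_one]

theorem forestSeries_succ (k s : ℕ) :
    forestSeries k (s + 1) = forestSeries k s + X * forestSeries k (s + k) := by
  ext n
  cases n <;> simp [forestSeries, forestCount, coeff_succ_X_mul]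

theorem forestSeries_mul (k s t : ℕ) :
    forestSeries k s * forestSeries k t = forestSeries k (s + t) := by
  ext n
  induction n, s using forestCount.induct k with
  | case1 s => simp [forestSeries, forestCount, coeff_mul]
  | case2 n => simp [forestSeries_zero]
  | case3 n s ih₁ ih₂ =>
    rw [show s + 1 + t = s + t + 1 by ring, forestSeries_succ, forestSeries_succ, add_mul, mul_assoc,
      map_add, map_add, coeff_succ_X_mul, coeff_succ_X_mul, ih₁, ih₂, add_right_comm]

theorem forestSeries_eq_pow (k s : ℕ) : forestSeries k s = forestSeries k 1 ^ s := by
  induction s with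
  | zero => simp [forestSeries_zero]
  | succ s ih => rw [pow_succ, ← ih, forestSeries_mul]

/-- The Fuss–Catalan series in `X ^ p`: the solution `F` of `F = 1 + X ^ p * F ^ k`. -/
noncomputable def fussSeries (p : ℕ) (hp : p ≠ 0) (k : ℕ) : ℚ⟦X⟧ :=
  expand p hp (forestSeries k 1)

theorem fussSeries_eq (p : ℕ) (hp : p ≠ 0) (k : ℕ) :
    fussSeries p hp k = 1 + X ^ p * fussSeries p hp k ^ k := by
  have h : forestSeries k 1 = 1 + X * forestSeries k 1 ^ k := by
    conv_lhs => rw [← zero_add 1, forestSeries_succ, forestSeries_zero, zero_add,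
      forestSeries_eq_pow]
  have := congrArg (expand p hp) h
  rwa [map_add, map_one, map_mul, expand_X, map_pow] at this

theorem fussSeries_zero (p : ℕ) (hp : p ≠ 0) : fussSeries p hp 0 = 1 + X ^ p := by
  rw [fussSeries_eq, pow_zero, mul_one]

theorem coeff_fussSeries (p : ℕ) (hp : p ≠ 0) (k : ℕ) (hk : 0 < k) (n : ℕ) :
    coeff (p * n) (fussSeries p hp k) = fussCatalan k n := by
  rw [fussSeries, coeff_expand_mul, forestSeries, coeff_mk,
    forestCount_closed_form k hk n 1 (by omega), fussCatalan]
  simp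

/-- An equation `Y = A + X * (B * Y ^ k)` has at most one solution: `1 - X * _` is never zero
and annihilates the difference of two solutions. -/
theorem eq_of_eq_add_X_mul {A B Y Z : ℚ⟦X⟧} {k : ℕ} (hY : Y = A + X * (B * Y ^ k))
    (hZ : Z = A + X * (B * Z ^ k)) : Y = Z := by
  obtain ⟨D, hD⟩ := sub_dvd_pow_sub_pow Y Z k
  have h : (Y - Z) * (1 - X * (B * D)) = 0 := by
    have : Y - Z = X * (B * (Y ^ k - Z ^ k)) := by
      conv_lhs => rw [hY, hZ]
      ring
    rw [hD] at this
    linear_combination this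
  rcases mul_eq_zero.1 h with h | h
  · exact sub_eq_zero.1 h
  · simpa using congrArg constantCoeff h

theorem hasSubst_X_mul (F : ℚ⟦X⟧) : HasSubst (X * F) :=
  HasSubst.of_constantCoeff_zero' (by simp)

/-- The Fuss–Catalan series are the iterates, starting from `1 + X ^ p`, of the passage
from `w` to the solution `F` of `F = w (X F)`. -/
theorem subst_fussSeries (p : ℕ) (hp : p ≠ 0) (r : ℕ) :
    (fussSeries p hp (r * p)).subst (X * fussSeries p hp ((r + 1) * p))
      = fussSeries p hp ((r + 1) * p) := by
  set F := fussSeries p hp ((r + 1) * p) with hF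
  obtain ⟨q, rfl⟩ : ∃ q, p = q + 1 := Nat.exists_eq_succ_of_ne_zero hp
  have hs := hasSubst_X_mul F
  refine eq_of_eq_add_X_mul (A := 1) (B := X ^ q * F ^ (q + 1)) (k := r * (q + 1)) ?_ ?_
  · conv_lhs => rw [fussSeries_eq]
    rw [← coe_substAlgHom hs, map_add, map_one, map_mul, map_pow, map_pow, substAlgHom_X]
    ring
  · conv_lhs => rw [hF, fussSeries_eq, ← hF]
    ring

theorem subst_X_mul_eq (F v : ℚ⟦X⟧) : v.subst (X * F)
    = X * F * (mk fun i => coeff (i + 1) v).subst (X * F) + C (constantCoeff v) := by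
  have hs := hasSubst_X_mul F
  have hC : (C (constantCoeff v) : ℚ⟦X⟧).subst (X * F) = C (constantCoeff v) := subst_C _
  conv_lhs => rw [eq_X_mul_shift_add_const v]
  rw [← coe_substAlgHom hs, map_add, map_mul, substAlgHom_X, coe_substAlgHom, hC]

theorem constantCoeff_subst_X_mul (F v : ℚ⟦X⟧) :
    constantCoeff (v.subst (X * F)) = constantCoeff v := by
  have h := congrArg constantCoeff (subst_X_mul_eq F v)
  rwa [map_add, map_mul, map_mul, constantCoeff_X, zero_mul, zero_mul, zero_add,
    constantCoeff_C] at h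

/-- Deleting the least point of a partition acts on weight series by `v ↦ (w v - w₀ v₀) / X`;
this is the matching recursion for the coefficients of `F * v (X F)`. -/
theorem coeff_succ_mul_subst {w F : ℚ⟦X⟧} (hF : w.subst (X * F) = F) (v : ℚ⟦X⟧) (n : ℕ) :
    coeff (n + 1) (F * v.subst (X * F))
      = coeff n (F * (mk fun i => coeff (i + 1) (w * v)).subst (X * F)) := by
  have h := subst_X_mul_eq F (w * v)
  rw [subst_mul (hasSubst_X_mul F), hF] at h
  rw [h, map_add, mul_assoc, coeff_succ_X_mul, coeff_C, if_neg (Nat.succ_ne_zero n), add_zero]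

theorem coeff_zero_mul_subst {w F : ℚ⟦X⟧} (hw : constantCoeff w = 1)
    (hF : w.subst (X * F) = F) (v : ℚ⟦X⟧) :
    coeff 0 (F * v.subst (X * F)) = coeff 0 v := by
  have hF1 : constantCoeff F = 1 := by rw [← hF, constantCoeff_subst_X_mul, hw]
  simp [constantCoeff_subst_X_mul, hF1]

/-! ### Noncrossing families of blocks -/

/-- A family of blocks is noncrossing if no two distinct blocks `B ∋ i, k` and `C ∋ j, l`
interlace as `i < j < k < l`. -/
def Noncrossing (𝓑 : Finset (Finset ℕ)) : Prop :=
  ∀ B ∈ 𝓑, ∀ C ∈ 𝓑, ∀ i ∈ B, ∀ k ∈ B, ∀ j ∈ C, ∀ l ∈ C, i < j → j < k → k < l → B = C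

/-- No point of `A` separates two points of the same block, that is, every block lies
in a single gap of `A`. -/
def Avoids (A : Finset ℕ) (𝓑 : Finset (Finset ℕ)) : Prop :=
  ∀ D ∈ 𝓑, ∀ x ∈ D, ∀ y ∈ D, ∀ t ∈ A, x < t → ¬ t < y

theorem avoids_empty (𝓑 : Finset (Finset ℕ)) : Avoids ∅ 𝓑 := by
  simp [Avoids]

theorem avoids_union {A C : Finset ℕ} {𝓑 : Finset (Finset ℕ)} :
    Avoids (A ∪ C) 𝓑 ↔ Avoids A 𝓑 ∧ Avoids C 𝓑 := by
  simp only [Avoids, mem_union]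
  grind

theorem avoids_insert_of_lt {b : ℕ} {A : Finset ℕ} {𝓑 : Finset (Finset ℕ)}
    (hb : ∀ D ∈ 𝓑, ∀ x ∈ D, b < x) : Avoids (insert b A) 𝓑 ↔ Avoids A 𝓑 := by
  simp only [Avoids, mem_insert]
  grind

theorem noncrossing_insert_block {a : ℕ} {A : Finset ℕ} {𝓑 : Finset (Finset ℕ)}
    (ha : ∀ D ∈ 𝓑, ∀ x ∈ D, a < x) :
    Noncrossing (insert (insert a A) 𝓑) ↔ Noncrossing 𝓑 ∧ Avoids A 𝓑 := by
  constructor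
  · refine fun h => ⟨fun B hB C hC => h B (mem_insert_of_mem hB) C (mem_insert_of_mem hC), ?_⟩
    intro D hD x hx y hy t ht hxt hty
    have e := h _ (mem_insert_self _ _) D (mem_insert_of_mem hD) a (mem_insert_self _ _) t
      (mem_insert_of_mem ht) x hx y hy (ha D hD x hx) hxt hty
    exact lt_irrefl a (ha D hD a (e ▸ mem_insert_self _ _))
  · rintro ⟨h₁, h₂⟩ B hB C hC i hi k hk j hj l hl hij hjk hkl
    rcases mem_insert.1 hB with rfl | hB <;> rcases mem_insert.1 hC with rfl | hC
    · rfl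
    · have hk' : k ∈ A := (mem_insert.1 hk).resolve_left (by grind)
      exact absurd hkl (h₂ C hC j hj l hl k hk' hjk)
    · have hj' : j ∈ A := (mem_insert.1 hj).resolve_left (by grind)
      exact absurd hjk (h₂ B hB i hi k hk j hj' hij)
    · exact h₁ B hB C hC i hi k hk j hj l hl hij hjk hkl

theorem avoids_insert_block {b : ℕ} {A C : Finset ℕ} {𝓑 : Finset (Finset ℕ)}
    (hb : ∀ t ∈ A, b < t) (hAC : Disjoint A C) :
    Avoids A (insert (insert b C) 𝓑) ↔ Avoids A 𝓑 ∧ ∀ c ∈ C, ∀ t ∈ A, c < t := by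
  rw [Finset.disjoint_left] at hAC
  constructor
  · refine fun h => ⟨fun D hD => h D (mem_insert_of_mem hD), fun c hc t ht => ?_⟩
    have := h _ (mem_insert_self _ _) b (mem_insert_self _ _) c (mem_insert_of_mem hc) t ht (hb t ht)
    grind
  · rintro ⟨h₁, h₂⟩ D hD x hx y hy t ht hxt hty
    rcases mem_insert.1 hD with rfl | hD
    · rcases mem_insert.1 hy with rfl | hy
      · exact lt_asymm hty (hb t ht)
      · exact lt_asymm hty (h₂ y hy t ht)
    · exact h₁ D hD x hx y hy t ht hxt hty

/-! ### Weighted sums over noncrossing partitions -/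

/-- A partition of `insert a S` amounts to the rest `A` of the block of `a` and a partition
of `S \ A`. -/
theorem sum_finpartition_insert {a : ℕ} {S : Finset ℕ} (ha : a ∉ S)
    (f : Finset (Finset ℕ) → ℚ) :
    ∑ P : Finpartition (insert a S), f P.parts
      = ∑ A ∈ S.powerset, ∑ R : Finpartition (S \ A), f (insert (insert a A) R.parts) := by
  have hne : ∀ A : Finset ℕ, insert a A ≠ ⊥ := fun A => insert_ne_empty a A
  have hdisj : ∀ A ∈ S.powerset, Disjoint (S \ A) (insert a A) := fun A _ => by
    rw [Finset.disjoint_left]; grind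
  have hsup : ∀ A ∈ S.powerset, (S \ A) ⊔ insert a A = insert a S := fun A hA => by
    ext x; have := mem_powerset.1 hA; simp only [sup_eq_union, mem_union]; grind
  rw [sum_sigma']
  symm
  refine sum_bij
    (fun x hx => x.2.extend (hne x.1) (hdisj _ (mem_sigma.1 hx).1) (hsup _ (mem_sigma.1 hx).1))
    (fun _ _ => mem_univ _) ?_ ?_ (fun _ _ => rfl)
  · rintro ⟨A, R⟩ hx ⟨A', R'⟩ hx' h
    have hp : insert (insert a A) R.parts = insert (insert a A') R'.parts :=
      congrArg Finpartition.parts h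
    have hA : A ⊆ S := mem_powerset.1 (mem_sigma.1 hx).1
    have hA' : A' ⊆ S := mem_powerset.1 (mem_sigma.1 hx').1
    have hR : ∀ D, a ∈ D → D ∉ R.parts := fun D hD hDR => ha (mem_sdiff.1 (R.le hDR hD)).1
    have hR' : ∀ D, a ∈ D → D ∉ R'.parts := fun D hD hDR => ha (mem_sdiff.1 (R'.le hDR hD)).1
    have e : insert a A = insert a A' := by
      have h₁ : insert a A ∈ insert (insert a A') R'.parts := hp ▸ mem_insert_self _ _
      exact (mem_insert.1 h₁).resolve_right (hR' _ (mem_insert_self _ _))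
    obtain rfl : A = A' := by
      rw [← erase_insert (fun h => ha (hA h)), e, erase_insert (fun h => ha (hA' h))]
    obtain rfl : R = R' := by
      ext1
      rw [← erase_insert (hR _ (mem_insert_self a A)), hp,
        erase_insert (hR' _ (mem_insert_self a A))]
    rfl
  · intro P _
    have haP : a ∈ P.part a := P.mem_part_self.2 (mem_insert_self _ _)
    have hPm : P.part a ∈ P.parts := P.part_mem.2 (mem_insert_self _ _)
    have hsub : P.part a ⊆ insert a S := P.part_subset a
    have hA : (P.part a).erase a ∈ S.powerset := by
      rw [mem_powerset]; intro x hx; have := hsub (mem_of_mem_erase hx); grind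
    refine ⟨⟨(P.part a).erase a, P.ofSubset (parts := P.parts.erase (P.part a))
      (erase_subset _ _) ?_⟩, mem_sigma.2 ⟨hA, mem_univ _⟩, ?_⟩
    · ext x
      simp only [mem_sup, id, mem_erase, mem_sdiff]
      constructor
      · rintro ⟨D, ⟨hD, hDP⟩, hx⟩
        have hxP : x ∉ P.part a := fun h => hD (P.eq_of_mem_parts hDP hPm hx h)
        have := P.le hDP hx
        have hxa : x ≠ a := fun h => hxP (h ▸ haP)
        exact ⟨(mem_insert.1 this).resolve_left hxa, fun h => hxP h.2⟩
      · rintro ⟨hxS, hx⟩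
        have hxa : x ≠ a := fun h => ha (h ▸ hxS)
        obtain ⟨D, hD, hxD⟩ := P.exists_mem (mem_insert_of_mem hxS)
        exact ⟨D, ⟨fun h => hx ⟨hxa, h ▸ hxD⟩, hD⟩, hxD⟩
    · ext1
      simp only [Finpartition.extend_parts, Finpartition.ofSubset_parts, insert_erase haP,
        insert_erase hPm]

open Classical in
/-- The weighted sum over the noncrossing partitions of `T` all of whose blocks lie in gaps of `A`;
a block of size `d` has weight `coeff d w`. -/
noncomputable def gapSum (w : ℚ⟦X⟧) (A T : Finset ℕ) : ℚ :=
  ∑ R : Finpartition T,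
    if Noncrossing R.parts ∧ Avoids A R.parts then ∏ D ∈ R.parts, coeff #D w else 0

/-- The weighted sum over the noncrossing partitions of a set consisting of `S` and one smaller
point, where the block of that point has weight `coeff d v` if it has `d` further points, and all
other blocks have weights given by `w`. -/
noncomputable def blockSum (w v : ℚ⟦X⟧) (S : Finset ℕ) : ℚ :=
  ∑ A ∈ S.powerset, coeff #A v * gapSum w A (S \ A)

theorem gapSum_insert_left (w : ℚ⟦X⟧) {b : ℕ} {A T : Finset ℕ} (hb : ∀ t ∈ T, b < t) :
    gapSum w (insert b A) T = gapSum w A T := by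
  refine sum_congr rfl fun R _ => ?_
  rw [avoids_insert_of_lt fun D hD x hx => hb x (R.le hD hx)]

theorem gapSum_empty (w : ℚ⟦X⟧) : gapSum w ∅ ∅ = 1 := by
  have hp : ∀ R : Finpartition (∅ : Finset ℕ), R.parts = ∅ :=
    fun R => Finpartition.parts_eq_empty_iff.2 rfl
  have : ∀ R : Finpartition (∅ : Finset ℕ), Noncrossing R.parts ∧ Avoids ∅ R.parts := by
    intro R; rw [hp]; exact ⟨by simp [Noncrossing], avoids_empty _⟩
  rw [gapSum, sum_congr rfl fun R _ => if_pos (this R), sum_congr rfl fun R _ => by rw [hp R]]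
  have : Unique (Finpartition (∅ : Finset ℕ)) := inferInstanceAs (Unique (Finpartition ⊥))
  simp

open Classical in
theorem gapSum_insert_right (w : ℚ⟦X⟧) {b : ℕ} {A T : Finset ℕ} (hbT : ∀ t ∈ T, b < t)
    (hbA : ∀ t ∈ A, b < t) (hAT : Disjoint A T) :
    gapSum w A (insert b T)
      = ∑ C ∈ T.powerset with ∀ c ∈ C, ∀ t ∈ A, c < t,
          coeff (#C + 1) w * gapSum w (A ∪ C) (T \ C) := by
  have hb : b ∉ T := fun h => lt_irrefl b (hbT b h)
  rw [gapSum, sum_finpartition_insert hb fun 𝓑 =>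
    if Noncrossing 𝓑 ∧ Avoids A 𝓑 then ∏ D ∈ 𝓑, coeff #D w else 0, sum_filter]
  refine sum_congr rfl fun C hC => ?_
  have hC := mem_powerset.1 hC
  have hbC : b ∉ C := fun h => hb (hC h)
  have key : ∀ R : Finpartition (T \ C),
      (Noncrossing (insert (insert b C) R.parts) ∧ Avoids A (insert (insert b C) R.parts)) ↔
      ((∀ c ∈ C, ∀ t ∈ A, c < t) ∧ Noncrossing R.parts ∧ Avoids (A ∪ C) R.parts) := by
    intro R
    rw [noncrossing_insert_block (fun D hD x hx => hbT x (mem_sdiff.1 (R.le hD hx)).1),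
      avoids_insert_block hbA (hAT.mono_right hC), avoids_union]
    tauto
  have hprod : ∀ R : Finpartition (T \ C), ∏ D ∈ insert (insert b C) R.parts, coeff #D w
      = coeff (#C + 1) w * ∏ D ∈ R.parts, coeff #D w := by
    intro R
    rw [prod_insert, card_insert_of_notMem hbC]
    exact fun h => hb (mem_sdiff.1 (R.le h (mem_insert_self _ _))).1
  split_ifs with h
  · rw [gapSum, mul_sum]
    refine sum_congr rfl fun R _ => ?_
    rw [hprod, mul_ite, mul_zero]
    exact if_congr (by rw [key]; tauto) rfl rfl
  · refine sum_eq_zero fun R _ => if_neg ?_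
    rw [key]; tauto

open Classical in
/-- A finite set of `n` numbers has exactly one initial segment of each size `0, …, n`. -/
theorem sum_initial_segments (M : Finset ℕ) (g : ℕ → ℚ) :
    ∑ C ∈ M.powerset with ∀ c ∈ C, ∀ t ∈ M \ C, c < t, g #C = ∑ i ∈ range (#M + 1), g i := by
  induction M using Finset.induction_on_max with
  | empty => simp
  | insert a M ha ih =>
    have haM : a ∉ M := fun h => lt_irrefl a (ha a h)
    rw [sum_filter, sum_powerset_insert haM, card_insert_of_notMem haM, sum_range_succ, ← ih,
      sum_filter]
    congr 1
    · refine sum_congr rfl fun C hC => if_congr ?_ rfl rfl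
      have := mem_powerset.1 hC
      constructor
      · exact fun h c hc t ht => h c hc t (by grind)
      · intro h c hc t ht
        rcases eq_or_ne t a with rfl | hta
        · exact ha c (this hc)
        · exact h c hc t (by grind)
    · rw [sum_eq_single_of_mem M (mem_powerset_self M), if_pos, card_insert_of_notMem haM]
      · simp
      · intro C hC hCM
        rw [if_neg]
        intro h
        obtain ⟨t, ht, htC⟩ := exists_of_ssubset (ssubset_of_subset_of_ne (mem_powerset.1 hC) hCM)
        have := h a (mem_insert_self _ _) t (by grind)
        exact lt_asymm this (ha t ht)

theorem blockSum_empty (w v : ℚ⟦X⟧) : blockSum w v ∅ = coeff 0 v := by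
  simp [blockSum, gapSum_empty]

open Classical in
/-- Delete the least point `a` in front of `insert b S`, joining its block to the block of `b`.
The joined block `M` arises from the block of `a` containing `b`, or from cutting `M` into
a nonempty initial segment, the former block of `b`, and a rest, which belonged to `a`. -/
theorem blockSum_insert {w : ℚ⟦X⟧} (hw : constantCoeff w = 1) (v : ℚ⟦X⟧) {b : ℕ} {S : Finset ℕ}
    (hb : ∀ t ∈ S, b < t) :
    blockSum w v (insert b S) = blockSum w (mk fun i => coeff (i + 1) (w * v)) S := by
  have hbS : b ∉ S := fun h => lt_irrefl b (hb b h)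
  have h₁ : ∑ A ∈ S.powerset, coeff #A v * gapSum w A (insert b S \ A)
      = ∑ M ∈ S.powerset, (∑ i ∈ range (#M + 1), coeff (i + 1) w * coeff (#M - i) v)
          * gapSum w M (S \ M) := by
    calc _ = ∑ A ∈ S.powerset, ∑ C ∈ (S \ A).powerset with ∀ c ∈ C, ∀ t ∈ A, c < t,
          coeff #A v * (coeff (#C + 1) w * gapSum w (A ∪ C) ((S \ A) \ C)) := by
          refine sum_congr rfl fun A hA => ?_
          have hA := mem_powerset.1 hA
          rw [insert_sdiff_of_notMem _ fun h => hbS (hA h), gapSum_insert_right w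
            (fun t ht => hb t (mem_sdiff.1 ht).1) (fun t ht => hb t (hA ht)) disjoint_sdiff,
            mul_sum]
      _ = ∑ M ∈ S.powerset, ∑ C ∈ M.powerset with ∀ c ∈ C, ∀ t ∈ M \ C, c < t,
          (coeff (#C + 1) w * coeff (#M - #C) v) * gapSum w M (S \ M) := by
          rw [sum_sigma', sum_sigma']
          refine sum_bij' (fun x _ => ⟨x.1 ∪ x.2, x.2⟩) (fun x _ => ⟨x.1 \ x.2, x.2⟩) ?_ ?_ ?_ ?_ ?_
          · rintro ⟨A, C⟩ h
            simp only [mem_sigma, mem_powerset, mem_filter] at h ⊢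
            obtain ⟨hA, hC, hCA⟩ := h
            exact ⟨union_subset hA (hC.trans sdiff_subset), subset_union_right,
              fun c hc t ht => hCA c hc t (by grind)⟩
          · rintro ⟨M, C⟩ h
            simp only [mem_sigma, mem_powerset, mem_filter] at h ⊢
            obtain ⟨hM, hC, hCM⟩ := h
            exact ⟨sdiff_subset.trans hM, fun x hx => by grind, hCM⟩
          · rintro ⟨A, C⟩ h
            simp only [mem_sigma, mem_powerset, mem_filter] at h
            have : (A ∪ C) \ C = A := by
              ext x; have := @h.2.1 x; grind
            simp only [this]
          · rintro ⟨M, C⟩ h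
            simp only [mem_sigma, mem_powerset, mem_filter] at h
            simp only [sdiff_union_of_subset h.2.1]
          · rintro ⟨A, C⟩ h
            simp only [mem_sigma, mem_powerset, mem_filter] at h
            have hd : Disjoint A C := by
              rw [Finset.disjoint_left]; intro x; have := @h.2.1 x; grind
            simp only [card_union_of_disjoint hd, Nat.add_sub_cancel, sdiff_sdiff_left, sup_eq_union]
            ring
      _ = _ := by
          refine sum_congr rfl fun M _ => ?_
          rw [← sum_mul, sum_initial_segments M fun i => coeff (i + 1) w * coeff (#M - i) v]
  have h₂ : ∑ A ∈ S.powerset, coeff #(insert b A) v * gapSum w (insert b A) (insert b S \ insert b A)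
      = ∑ M ∈ S.powerset, coeff (#M + 1) v * gapSum w M (S \ M) := by
    refine sum_congr rfl fun A hA => ?_
    have hA := mem_powerset.1 hA
    have e : insert b S \ insert b A = S \ A := by
      ext x; simp only [mem_sdiff, mem_insert]; grind
    rw [card_insert_of_notMem fun h => hbS (hA h), e,
      gapSum_insert_left w fun t ht => hb t (mem_sdiff.1 ht).1]
  rw [blockSum, sum_powerset_insert hbS, h₁, h₂, ← sum_add_distrib, blockSum]
  refine sum_congr rfl fun M _ => ?_
  rw [coeff_mk, coeff_mul, Finset.Nat.sum_antidiagonal_eq_sum_range_succ_mk,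
    sum_range_succ' _ (#M + 1), ← add_mul]
  simp [hw]

theorem blockSum_eq_coeff {w F : ℚ⟦X⟧} (hw : constantCoeff w = 1) (hF : w.subst (X * F) = F)
    (S : Finset ℕ) (v : ℚ⟦X⟧) : blockSum w v S = coeff #S (F * v.subst (X * F)) := by
  induction S using Finset.induction_on_min generalizing v with
  | empty => rw [blockSum_empty, card_empty, coeff_zero_mul_subst hw hF]
  | insert b S hb ih =>
    rw [blockSum_insert hw v hb, ih, card_insert_of_notMem fun h => lt_irrefl b (hb b h),
      coeff_succ_mul_subst hF]

/-- The weighted sum over the noncrossing partitions of an `n`-element set is the coefficient of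
`X ^ n` in the solution `F` of `F = w (X F)`. -/
theorem gapSum_eq_coeff {w F : ℚ⟦X⟧} (hw : constantCoeff w = 1) (hF : w.subst (X * F) = F)
    (S : Finset ℕ) : gapSum w ∅ S = coeff #S F := by
  induction S using Finset.induction_on_min with
  | empty =>
    rw [gapSum_empty, card_empty, coeff_zero_eq_constantCoeff_apply, ← hF,
      constantCoeff_subst_X_mul, hw]
  | insert b S hb ih =>
    have h : gapSum w ∅ (insert b S) = blockSum w (mk fun i => coeff (i + 1) w) S := by
      rw [gapSum_insert_right w hb (by simp) (disjoint_empty_left S), blockSum]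
      simp
    rw [h, blockSum_eq_coeff hw hF, card_insert_of_notMem fun h => lt_irrefl b (hb b h)]
    conv_rhs => rw [← hF, subst_X_mul_eq F w]
    rw [map_add, mul_assoc, coeff_succ_X_mul, coeff_C, if_neg (Nat.succ_ne_zero _), add_zero]

/-! ### Refinements of a noncrossing partition -/

theorem noncrossing_bind {S : Finset ℕ} {P : Finpartition S} (hP : Noncrossing P.parts)
    (Q : ∀ C ∈ P.parts, Finpartition C) :
    Noncrossing (P.bind Q).parts ↔ ∀ C (hC : C ∈ P.parts), Noncrossing (Q C hC).parts := by
  constructor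
  · exact fun h C hC B hB B' hB' => h B (Finpartition.mem_bind.2 ⟨C, hC, hB⟩) B'
      (Finpartition.mem_bind.2 ⟨C, hC, hB'⟩)
  · intro h B hB B' hB' i hi k hk j hj l hl hij hjk hkl
    obtain ⟨C, hC, hB⟩ := Finpartition.mem_bind.1 hB
    obtain ⟨C', hC', hB'⟩ := Finpartition.mem_bind.1 hB'
    obtain rfl := hP C hC C' hC' i ((Q C hC).le hB hi) k ((Q C hC).le hB hk)
      j ((Q C' hC').le hB' hj) l ((Q C' hC').le hB' hl) hij hjk hkl
    exact h C hC B hB B' hB' i hi k hk j hj l hl hij hjk hkl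

theorem Finpartition.bind_le {S : Finset ℕ} (P : Finpartition S)
    (Q : ∀ C ∈ P.parts, Finpartition C) : P.bind Q ≤ P := by
  intro D hD
  obtain ⟨C, hC, hD⟩ := Finpartition.mem_bind.1 hD
  exact ⟨C, hC, (Q C hC).le hD⟩

theorem Finpartition.mem_parts_of_mem_bind {S : Finset ℕ} {P : Finpartition S}
    {Q : ∀ C ∈ P.parts, Finpartition C} {C D : Finset ℕ} (hC : C ∈ P.parts) (hDC : D ⊆ C)
    (hD : D ∈ (P.bind Q).parts) : D ∈ (Q C hC).parts := by
  obtain ⟨C', hC', hD⟩ := Finpartition.mem_bind.1 hD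
  obtain ⟨x, hx⟩ := (Q C' hC').nonempty_of_mem_parts hD
  obtain rfl := P.eq_of_mem_parts hC hC' (hDC hx) ((Q C' hC').le hD hx)
  exact hD

theorem Finpartition.bind_injective {S : Finset ℕ} (P : Finpartition S) :
    Function.Injective (P.bind (α := Finset ℕ)) := by
  have key : ∀ Q Q' : ∀ C ∈ P.parts, Finpartition C, P.bind Q = P.bind Q' →
      ∀ C hC, (Q C hC).parts ⊆ (Q' C hC).parts := fun Q Q' h C hC D hD =>
    mem_parts_of_mem_bind hC ((Q C hC).le hD) (h ▸ Finpartition.mem_bind.2 ⟨C, hC, hD⟩)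
  intro Q Q' h
  funext C hC
  ext1
  exact (key Q Q' h C hC).antisymm (key Q' Q h.symm C hC)

theorem Finpartition.exists_bind_eq {S : Finset ℕ} {P P' : Finpartition S} (h : P' ≤ P) :
    ∃ Q : ∀ C ∈ P.parts, Finpartition C, P.bind Q = P' := by
  refine ⟨fun C hC => P'.ofSubset (parts := P'.parts.filter (· ⊆ C)) (filter_subset _ _) ?_, ?_⟩
  · ext x
    simp only [mem_sup, id, mem_filter]
    constructor
    · rintro ⟨D, ⟨-, hDC⟩, hx⟩
      exact hDC hx
    · intro hx
      obtain ⟨D, hD, hxD⟩ := P'.exists_mem (P.le hC hx)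
      obtain ⟨C', hC', hDC'⟩ := h hD
      obtain rfl := P.eq_of_mem_parts hC hC' hx (hDC' hxD)
      exact ⟨D, ⟨hD, hDC'⟩, hxD⟩
  · ext D
    simp only [Finpartition.mem_bind, Finpartition.ofSubset_parts, mem_filter]
    constructor
    · rintro ⟨C, hC, hD, -⟩
      exact hD
    · intro hD
      obtain ⟨C, hC, hDC⟩ := h hD
      exact ⟨C, hC, hD, hDC⟩

theorem Finpartition.prod_bind {S : Finset ℕ} (P : Finpartition S)
    (Q : ∀ C ∈ P.parts, Finpartition C) (f : Finset ℕ → ℚ) :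
    ∏ D ∈ (P.bind Q).parts, f D = ∏ C ∈ P.parts.attach, ∏ D ∈ (Q C.1 C.2).parts, f D := by
  rw [Finpartition.bind_parts, prod_biUnion]
  rintro ⟨C, hC⟩ - ⟨C', hC'⟩ - hne
  rw [Function.onFun, Finset.disjoint_left]
  intro D hD hD'
  obtain ⟨x, hx⟩ := (Q C hC).nonempty_of_mem_parts hD
  exact hne (Subtype.ext (P.eq_of_mem_parts hC hC' ((Q C hC).le hD hx) ((Q C' hC').le hD' hx)))

open Classical in
/-- Noncrossing refinements of a noncrossing partition are chosen independently in each block. -/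
theorem sum_noncrossing_refinements (w : ℚ⟦X⟧) {S : Finset ℕ} {P : Finpartition S}
    (hP : Noncrossing P.parts) :
    ∑ P' : Finpartition S,
        (if Noncrossing P'.parts ∧ P' ≤ P then ∏ D ∈ P'.parts, coeff #D w else 0)
      = ∏ C ∈ P.parts, gapSum w ∅ C := by
  simp only [gapSum, prod_sum]
  symm
  have hfilter : ∑ P' : Finpartition S,
        (if Noncrossing P'.parts ∧ P' ≤ P then ∏ D ∈ P'.parts, coeff #D w else 0)
      = ∑ P' : Finpartition S with P' ≤ P,
        (if Noncrossing P'.parts then ∏ D ∈ P'.parts, coeff #D w else 0) := by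
    rw [sum_filter]
    refine sum_congr rfl fun P' _ => ?_
    split_ifs <;> tauto
  rw [hfilter]
  refine sum_bij (fun Q _ => P.bind Q) (fun Q _ => by simp [P.bind_le Q])
    (fun Q _ Q' _ h => P.bind_injective h) ?_ ?_
  · intro P' hP'
    obtain ⟨Q, hQ⟩ := Finpartition.exists_bind_eq (mem_filter.1 hP').2
    exact ⟨Q, by simp, hQ⟩
  · intro Q _
    rw [prod_ite_zero, P.prod_bind Q]
    have hiff : (∀ C ∈ P.parts.attach, Noncrossing (Q C.1 C.2).parts ∧
        Avoids ∅ (Q C.1 C.2).parts) ↔ Noncrossing (P.bind Q).parts := by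
      rw [noncrossing_bind hP]
      simp [avoids_empty]
    by_cases h : Noncrossing (P.bind Q).parts
    · rw [if_pos h, if_pos (hiff.2 h)]
    · rw [if_neg h, if_neg (mt hiff.1 h)]

/-! ### Chains of noncrossing partitions -/

/-- An increasing chain of `m + 1` noncrossing partitions. -/
def IsNoncrossingChain {m : ℕ} {S : Finset ℕ} (Q : Fin (m + 1) → Finpartition S) : Prop :=
  (∀ r, Noncrossing (Q r).parts) ∧ ∀ r : Fin m, Q r.castSucc ≤ Q r.succ

theorem isNoncrossingChain_cons {m : ℕ} {S : Finset ℕ} (P : Finpartition S)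
    (Q : Fin (m + 1) → Finpartition S) :
    IsNoncrossingChain (Fin.cons P Q : Fin (m + 2) → Finpartition S) ↔
      (Noncrossing P.parts ∧ P ≤ Q 0) ∧ IsNoncrossingChain Q := by
  constructor
  · exact fun ⟨h₁, h₂⟩ => ⟨⟨h₁ 0, h₂ 0⟩, fun r => h₁ r.succ, fun r => h₂ r.succ⟩
  · exact fun ⟨⟨h₁, h₂⟩, h₃, h₄⟩ => ⟨Fin.cases h₁ h₃, Fin.cases h₂ h₄⟩

open Classical in
/-- The sum over chains of `m + 1` noncrossing partitions of `S`, weighted by the sizes of the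
blocks of the finest one. -/
noncomputable def chainSum (m : ℕ) (w : ℚ⟦X⟧) (S : Finset ℕ) : ℚ :=
  ∑ Q : Fin (m + 1) → Finpartition S,
    if IsNoncrossingChain Q then ∏ D ∈ (Q 0).parts, coeff #D w else 0

theorem chainSum_zero (w : ℚ⟦X⟧) (S : Finset ℕ) : chainSum 0 w S = gapSum w ∅ S := by
  rw [chainSum, gapSum]
  refine Fintype.sum_equiv (Equiv.funUnique (Fin 1) _) _ _ fun Q => ?_
  have hiff : IsNoncrossingChain Q ↔ Noncrossing (Q 0).parts ∧ Avoids ∅ (Q 0).parts := by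
    simp [IsNoncrossingChain, avoids_empty]
  by_cases h : IsNoncrossingChain Q
  · exact (if_pos h).trans (if_pos (hiff.1 h)).symm
  · exact (if_neg h).trans (if_neg (mt hiff.2 h)).symm

/-- Summing over the finest partition of a chain turns the weights `w` of its blocks
into the weights `F` of the blocks of the next partition. -/
theorem chainSum_succ {w F : ℚ⟦X⟧} (hw : constantCoeff w = 1) (hF : w.subst (X * F) = F)
    (m : ℕ) (S : Finset ℕ) : chainSum (m + 1) w S = chainSum m F S := by
  classical
  rw [chainSum, ← (Fin.consEquiv fun _ : Fin (m + 2) => Finpartition S).sum_comp,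
    Fintype.sum_prod_type_right, chainSum]
  refine sum_congr rfl fun Q _ => ?_
  have hcons : ∀ P : Finpartition S,
      IsNoncrossingChain ((Fin.consEquiv fun _ : Fin (m + 2) => Finpartition S) (P, Q)) ↔
        (Noncrossing P.parts ∧ P ≤ Q 0) ∧ IsNoncrossingChain Q := fun P =>
    isNoncrossingChain_cons P Q
  simp only [hcons]
  split_ifs with h
  · simp only [h, and_true]
    rw [← prod_congr rfl fun C _ => gapSum_eq_coeff hw hF C, ← sum_noncrossing_refinements w (h.1 0)]
    rfl
  · simp [h]

theorem constantCoeff_fussSeries (p : ℕ) (hp : p ≠ 0) (k : ℕ) :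
    constantCoeff (fussSeries p hp k) = 1 := by
  rw [fussSeries_eq]
  simp [hp]

theorem chainSum_fussSeries (p : ℕ) (hp : p ≠ 0) (m r : ℕ) (S : Finset ℕ) :
    chainSum m (fussSeries p hp (r * p)) S = coeff #S (fussSeries p hp ((r + m + 1) * p)) := by
  have hw := constantCoeff_fussSeries p hp
  induction m generalizing r with
  | zero => rw [chainSum_zero, gapSum_eq_coeff (hw _) (subst_fussSeries p hp r), add_zero]
  | succ m ih =>
    rw [chainSum_succ (hw _) (subst_fussSeries p hp r), ih, show r + 1 + m = r + (m + 1) by ring]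

/-! ### Planarity of the standard diagram -/

/-- The arcs of the standard diagram detect all crossings: two interlacing blocks contain two
crossing arcs, namely the steps over a suitable point of the other block. -/
theorem SetPartition.isPlanar_iff {N : ℕ} (P : SetPartition N) :
    P.IsPlanar ↔ Noncrossing P.parts := by
  -- A point outside a block, but between two of its points, lies under an arc of the block.
  have step : ∀ B ∈ P.parts, ∀ i ∈ B, ∀ k ∈ B, ∀ j, j ∉ B → i < j → j < k →
      ∃ i' ∈ B, ∃ k' ∈ B, P.IsArc i' k' ∧ i ≤ i' ∧ i' < j ∧ j < k' ∧ k' ≤ k := by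
    intro B hB i hi k hk j hj hij hjk
    have h₁ : (B.filter (· < j)).Nonempty := ⟨i, mem_filter.2 ⟨hi, hij⟩⟩
    have h₂ : (B.filter (j < ·)).Nonempty := ⟨k, mem_filter.2 ⟨hk, hjk⟩⟩
    obtain ⟨m₁, m₁'⟩ := mem_filter.1 (max'_mem _ h₁)
    obtain ⟨m₂, m₂'⟩ := mem_filter.1 (min'_mem _ h₂)
    refine ⟨_, m₁, _, m₂, ⟨m₁'.trans m₂', B, hB, m₁, m₂, ?_⟩, le_max' _ _ (by simp [hi, hij]),
      m₁', m₂', min'_le _ _ (by simp [hk, hjk])⟩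
    rintro x hx ⟨hx₁, hx₂⟩
    rcases lt_trichotomy x j with h | rfl | h
    · exact hx₁.not_ge (le_max' _ _ (by simp [hx, h]))
    · exact hj hx
    · exact hx₂.not_ge (min'_le _ _ (by simp [hx, h]))
  constructor
  · intro h B hB C hC i hi k hk j hj l hl hij hjk hkl
    by_contra hne
    have hd := Finset.disjoint_left.1 (P.disjoint hB hC hne)
    obtain ⟨i', hi', k', hk', harc, -, hij', hjk', hkk⟩ :=
      step B hB i hi k hk j (fun h => hd h hj) hij hjk
    obtain ⟨j', -, l', -, harc', hjj, hjk'', hkl', -⟩ :=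
      step C hC j hj l hl k' (fun h => hd hk' h) hjk' (hkk.trans_lt hkl)
    exact h i' j' k' l' harc harc' ⟨hij'.trans_le hjj, hjk'', hkl'⟩
  · rintro h i j k l ⟨-, B, hB, hi, hk, hB'⟩ ⟨-, C, hC, hj, hl, -⟩ ⟨hij, hjk, hkl⟩
    obtain rfl := h B hB C hC i hi k hk j hj l hl hij hjk hkl
    exact hB' j hj ⟨hij, hjk⟩

theorem isPlanarTuple_iff {m N : ℕ} (Q : Fin (m + 1) → SetPartition N) :
    IsPlanarTuple Q ↔ IsNoncrossingChain Q := by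
  simp only [IsPlanarTuple, IsNoncrossingChain, SetPartition.isPlanar_iff]
  refine and_congr_right fun _ => ⟨fun h r => h r.1 (by omega), fun h r hr => h ⟨r, by omega⟩⟩

open Classical in
/-- With `w = 1 + X ^ p`, the weight of a partition indicates whether all blocks have `p`
elements; blocks are nonempty, so the constant coefficient plays no role. -/
theorem SetPartition.prod_coeff_fussSeries {N p : ℕ} (hp : p ≠ 0) (P : SetPartition N) :
    ∏ D ∈ P.parts, coeff #D (fussSeries p hp 0) = if P.IsUniform p then 1 else 0 := by
  have : ∀ D ∈ P.parts, coeff #D (fussSeries p hp 0) = if #D = p then (1 : ℚ) else 0 := by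
    intro D hD
    have hD0 : #D ≠ 0 := (card_pos.2 (P.nonempty_of_mem_parts hD)).ne'
    rw [fussSeries_zero, map_add, coeff_one, if_neg hD0, zero_add, coeff_X_pow]
  rw [prod_congr rfl this, prod_ite_zero, prod_const_one]
  simp only [IsUniform]
  congr

theorem theorem3 (m p : ℕ) (hm : 0 < m) (hp : 0 < p) (n : ℕ) :
    ((Set.ncard {Q : Fin m → SetPartition (p * n) |
      IsPlanarTuple Q ∧ (Q ⟨0, hm⟩).IsUniform p} : ℕ) : ℚ) = fussCatalan (m * p) n := by
  classical
  obtain ⟨m, rfl⟩ : ∃ k, m = k + 1 := Nat.exists_eq_succ_of_ne_zero hm.ne'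
  have h := chainSum_fussSeries p hp.ne' m 0 (Icc 1 (p * n))
  rw [zero_add, zero_mul, Nat.card_Icc, Nat.add_sub_cancel,
    coeff_fussSeries p hp.ne' _ (Nat.mul_pos hm hp)] at h
  rw [← h, chainSum, Set.ncard_eq_toFinset_card', Set.toFinset_ofPred, card_filter, Nat.cast_sum]
  refine sum_congr rfl fun Q _ => ?_
  rw [SetPartition.prod_coeff_fussSeries hp.ne' (Q 0), ← ite_and, ← isPlanarTuple_iff]
  push_cast
  rfl
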